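/- Let $n\ge 1$, let $\rho>1$ be real, and let $z_1,\dots,z_n$ be complex numbers with $|z_j|\le\rho$ for $j=1,\dots,n$. Then \[ \prod_{j\ne k}\bigl|1-\overline{z_j}z_k\bigr|\le\left(\frac{\rho^{2n}-1}{\rho^2-1}\right)^{n}, \] where the product is over all ordered pairs $(j,k)$ with $j,k\in\{1,\dots,n\}$ and $j\ne k$. If $n\ge 2$, equality holds if and only if the $z_j$ are, in some order, the $n$ vertices of a regular $n$-gon inscribed in the circle $\{z\in\mathbb{C}:|z|=\rho\}$, that is, if and only if there are $w\in\mathbb{C}$ with $|w|=\rho$ and a permutation $\sigma$ of $\{1,\dots,n\}$ such that $z_j=w\,e^{2\pi i\sigma(j)/n}$ for all $j$ (for $n=2$: two antipodal points of the circle). -/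

import Mathlib

/-- The points `z 0, …, z (n - 1)` are, in some order, the `n` vertices of a regular `n`-gon
inscribed in the circle `|z| = ρ`: for some `w` with `|w| = ρ` they are the points
`w * exp (2 π i k / n)`, `k = 0, …, n - 1`, each listed exactly once.
For `n = 2` this says that they are two antipodal points of the circle. -/
def IsRegularNGonVertices (n : ℕ) (ρ : ℝ) (z : Fin n → ℂ) : Prop :=
  ∃ w : ℂ, ‖w‖ = ρ ∧ ∃ σ : Equiv.Perm (Fin n), ∀ j : Fin n,
    z j = w * Complex.exp (2 * (Real.pi : ℂ) * Complex.I * ((σ j : ℕ) : ℂ) / (n : ℂ))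

/-! By the maximum principle in each variable, the bound reduces to `z_j = ρ u_j` with `|u_j| = 1`.
With `r = ρ⁻²`, the logarithm of product over bound is `logEnergyGap u r`. It vanishes at `r = 0`,
and since `2r d/dr log|1 - rζ| = 1 - P_r(ζ)` with `P_r` the Poisson kernel, it decreases in `r` as
soon as the regular `n`-gon minimises the Poisson energy for every `r` (`poisson_energy_le`).

That is a linear programming bound, with `n = N + 1`. `hermiteMinorant` lies below a multiple of
`P_r`, the gap being a positive multiple of the Fejér kernel over `|1 - rζ|²`
(`hermiteMinorant_identity`). Its Fourier coefficients are nonnegative (`minorantCoeff_nonneg`), so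
its sum over all pairs is at least `n²` times its mean.

Equality on the circle makes the Fejér kernel vanish at every ratio `u_k / u_j`, so these are
nontrivial `n`-th roots of unity. Equality with some `z_j` inside the disc would persist when `z_j`
moves to any point of the circle, although the other vertices of a regular polygon determine the
last one. -/

/-- The Fejér kernel of order `N + 1`, scaled so that its value at `1` is `(N + 1) ^ 2`. -/
noncomputable def fejerKernel (N : ℕ) (ζ : ℂ) : ℝ :=
  (N + 1) + 2 * ∑ m ∈ Finset.range N, ((N : ℝ) - m) * (ζ ^ (m + 1)).re

/-- The Fourier coefficient of order `m + 1` of `hermiteMinorant`. -/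
noncomputable def minorantCoeff (N : ℕ) (r : ℝ) (m : ℕ) : ℝ :=
  r ^ (m + 1) - r ^ (2 * N + 2) * r⁻¹ ^ (m + 1) - ((N : ℝ) - m) * (r ^ N * (1 - r ^ 2))

/-- The trigonometric polynomial that interpolates `(1 - r ^ (N + 1)) ^ 2` times the Poisson kernel
to second order at the `(N + 1)`-st roots of unity other than `1`. -/
noncomputable def hermiteMinorant (N : ℕ) (r : ℝ) (ζ : ℂ) : ℝ :=
  (1 - r ^ (2 * N + 2) - (N + 1) * (r ^ N * (1 - r ^ 2))) +
    2 * ∑ m ∈ Finset.range N, minorantCoeff N r m * (ζ ^ (m + 1)).re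

/-! ### Kernel identities on the unit circle -/

theorem re_pow_add_two {ζ : ℂ} (hζ : ‖ζ‖ = 1) (m : ℕ) :
    (ζ ^ (m + 2)).re = 2 * ζ.re * (ζ ^ (m + 1)).re - (ζ ^ m).re := by
  have h : ζ * (starRingEnd ℂ) ζ = 1 := by
    rw [Complex.mul_conj, Complex.normSq_eq_norm_sq, hζ]; norm_num
  have h2 : ζ + (starRingEnd ℂ) ζ = ((2 * ζ.re : ℝ) : ℂ) := Complex.add_conj ζ
  have h3 : ζ ^ (m + 2) = ((2 * ζ.re : ℝ) : ℂ) * ζ ^ (m + 1) - ζ ^ m := by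
    rw [← h2]; linear_combination (-ζ ^ m) * h
  rw [h3, Complex.sub_re, Complex.re_ofReal_mul]

/-- The truncated Poisson series telescopes against its denominator. It is needed at `x = r`, at `x
= r⁻¹`, and at `x = 1` (the Dirichlet kernel). -/
theorem sum_geom_re_pow {ζ : ℂ} (hζ : ‖ζ‖ = 1) (x : ℝ) (N : ℕ) :
    (1 - 2 * x * ζ.re + x ^ 2) *
        (1 + 2 * ∑ m ∈ Finset.range N, x ^ (m + 1) * (ζ ^ (m + 1)).re) =
      1 - x ^ 2 - 2 * x ^ (N + 1) * (ζ ^ (N + 1)).re + 2 * x ^ (N + 2) * (ζ ^ N).re := by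
  induction N with
  | zero => simp; ring
  | succ N ih =>
    rw [Finset.sum_range_succ, re_pow_add_two hζ N]
    linear_combination ih

/-- Passing from `N` to `N + 1` adds a Dirichlet kernel, which is the case `x = 1` of
`sum_geom_re_pow`. -/
theorem fejerKernel_mul {ζ : ℂ} (hζ : ‖ζ‖ = 1) (N : ℕ) :
    (2 - 2 * ζ.re) * fejerKernel N ζ = 2 - 2 * (ζ ^ (N + 1)).re := by
  unfold fejerKernel
  induction N with
  | zero => simp
  | succ N ih =>
    have h := sum_geom_re_pow hζ 1 (N + 1)
    have h2 : ∑ m ∈ Finset.range (N + 1), (((N + 1 : ℕ) : ℝ) - m) * (ζ ^ (m + 1)).re =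
        ∑ m ∈ Finset.range N, ((N : ℝ) - m) * (ζ ^ (m + 1)).re +
          ∑ m ∈ Finset.range (N + 1), (ζ ^ (m + 1)).re := by
      have h3 : ∑ m ∈ Finset.range N, ((N : ℝ) - m) * (ζ ^ (m + 1)).re =
          ∑ m ∈ Finset.range (N + 1), ((N : ℝ) - m) * (ζ ^ (m + 1)).re := by
        rw [Finset.sum_range_succ]; simp
      rw [h3, ← Finset.sum_add_distrib]
      refine Finset.sum_congr rfl fun m _ => ?_
      push_cast; ring
    rw [h2]
    simp only [one_pow, one_mul] at h
    push_cast
    linear_combination ih + h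

theorem fejerKernel_one (N : ℕ) : fejerKernel N 1 = ((N : ℝ) + 1) ^ 2 := by
  have h : 2 * ∑ m ∈ Finset.range N, ((N : ℝ) - m) = N * (N + 1) := by
    induction N with
    | zero => simp
    | succ N ih =>
      rw [Finset.sum_range_succ]
      have : ∑ m ∈ Finset.range N, (((N + 1 : ℕ) : ℝ) - m) =
          ∑ m ∈ Finset.range N, ((N : ℝ) - m) + N := by
        have h4 : (N : ℝ) = ∑ m ∈ Finset.range N, (1 : ℝ) := by simp
        conv_rhs => rw [h4]
        rw [← Finset.sum_add_distrib]
        refine Finset.sum_congr rfl fun m _ => ?_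
        simp only [← h4]; push_cast; ring
      rw [this]; push_cast; linear_combination ih
  unfold fejerKernel
  simp only [one_pow, Complex.one_re, mul_one]
  rw [h]; ring

theorem eq_one_of_re_eq_one {ζ : ℂ} (hζ : ‖ζ‖ = 1) (h : ζ.re = 1) : ζ = 1 := by
  have h2 : ζ.re * ζ.re + ζ.im * ζ.im = 1 := by
    rw [← Complex.normSq_apply, Complex.normSq_eq_norm_sq, hζ]; norm_num
  rw [h] at h2
  apply Complex.ext
  · simpa using h
  · have : ζ.im * ζ.im = 0 := by linarith
    simpa using this

theorem fejerKernel_nonneg {ζ : ℂ} (hζ : ‖ζ‖ = 1) (N : ℕ) : 0 ≤ fejerKernel N ζ := by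
  rcases eq_or_ne ζ 1 with rfl | h1
  · rw [fejerKernel_one]; positivity
  · have hre : ζ.re < 1 :=
      lt_of_le_of_ne (hζ ▸ Complex.re_le_norm ζ) fun h => h1 (eq_one_of_re_eq_one hζ h)
    have h := fejerKernel_mul hζ N
    have h2 : (ζ ^ (N + 1)).re ≤ 1 := by
      refine (Complex.re_le_norm _).trans ?_
      rw [norm_pow, hζ, one_pow]
    exact nonneg_of_mul_nonneg_right (by rw [h]; linarith : 0 ≤ (2 - 2 * ζ.re) * _) (by linarith)

theorem pow_eq_one_of_fejerKernel_eq_zero {ζ : ℂ} (hζ : ‖ζ‖ = 1) {N : ℕ}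
    (h : fejerKernel N ζ = 0) : ζ ^ (N + 1) = 1 ∧ ζ ≠ 1 := by
  constructor
  · have h2 := fejerKernel_mul hζ N
    rw [h] at h2
    exact eq_one_of_re_eq_one (by rw [norm_pow, hζ, one_pow]) (by linarith)
  · rintro rfl
    rw [fejerKernel_one] at h
    have : (0 : ℝ) < ((N : ℝ) + 1) ^ 2 := by positivity
    linarith

/-- In the difference of the truncated Poisson series at `r` and at `r⁻¹` the `ζ ^ N` terms cancel,
and `fejerKernel_mul` absorbs the `ζ ^ (N + 1)` terms. The rest is `1 - 2rc + r² = (1 - r)² + r(2 -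
2c)` with `c = ζ.re`. -/
theorem hermiteMinorant_identity {ζ : ℂ} (hζ : ‖ζ‖ = 1) {r : ℝ} (hr : r ≠ 0) (N : ℕ) :
    (1 - 2 * r * ζ.re + r ^ 2) * hermiteMinorant N r ζ =
      (1 - r ^ 2) * (1 - r ^ (N + 1)) ^ 2 -
        (1 - r ^ 2) * (1 - r) ^ 2 * r ^ N * fejerKernel N ζ := by
  have h1 := sum_geom_re_pow hζ r N
  have h2 := sum_geom_re_pow hζ r⁻¹ N
  have h3 := fejerKernel_mul hζ N
  have hH : hermiteMinorant N r ζ =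
      (1 + 2 * ∑ m ∈ Finset.range N, r ^ (m + 1) * (ζ ^ (m + 1)).re) -
      r ^ (2 * N + 2) * (1 + 2 * ∑ m ∈ Finset.range N, r⁻¹ ^ (m + 1) * (ζ ^ (m + 1)).re) -
      r ^ N * (1 - r ^ 2) * fejerKernel N ζ := by
    have : ∑ m ∈ Finset.range N, minorantCoeff N r m * (ζ ^ (m + 1)).re =
        (∑ m ∈ Finset.range N, r ^ (m + 1) * (ζ ^ (m + 1)).re) -
        r ^ (2 * N + 2) * (∑ m ∈ Finset.range N, r⁻¹ ^ (m + 1) * (ζ ^ (m + 1)).re) -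
        r ^ N * (1 - r ^ 2) * ∑ m ∈ Finset.range N, ((N : ℝ) - m) * (ζ ^ (m + 1)).re := by
      rw [Finset.mul_sum, Finset.mul_sum, ← Finset.sum_sub_distrib, ← Finset.sum_sub_distrib]
      refine Finset.sum_congr rfl fun m _ => ?_
      unfold minorantCoeff; ring
    unfold hermiteMinorant fejerKernel
    rw [this]; ring
  rw [hH]
  have h2' : r ^ (2 * N + 2) * ((1 - 2 * r * ζ.re + r ^ 2) *
      (1 + 2 * ∑ m ∈ Finset.range N, r⁻¹ ^ (m + 1) * (ζ ^ (m + 1)).re)) =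
      r ^ (2 * N + 2) * (r ^ 2 - 1) - 2 * r ^ (N + 3) * (ζ ^ (N + 1)).re
        + 2 * r ^ (N + 2) * (ζ ^ N).re := by
    have e : (1 - 2 * r * ζ.re + r ^ 2) = r ^ 2 * (1 - 2 * r⁻¹ * ζ.re + r⁻¹ ^ 2) := by
      field_simp; ring
    rw [e, mul_assoc, h2]
    have e1 : r ^ (2 * N + 2) * r ^ 2 * r⁻¹ ^ (N + 1) = r ^ (N + 3) := by
      rw [inv_pow, show r ^ (2 * N + 2) * r ^ 2 = r ^ (N + 3) * r ^ (N + 1) by ring]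
      field_simp
    have e2 : r ^ (2 * N + 2) * r ^ 2 * r⁻¹ ^ (N + 2) = r ^ (N + 2) := by
      rw [inv_pow, show r ^ (2 * N + 2) * r ^ 2 = r ^ (N + 2) * r ^ (N + 2) by ring]
      field_simp
    have e3 : r ^ 2 * r⁻¹ ^ 2 = 1 := by field_simp
    linear_combination (-2 * (ζ ^ (N + 1)).re) * e1 + (2 * (ζ ^ N).re) * e2
      - r ^ (2 * N + 2) * e3
  linear_combination h1 - h2' - r ^ (N + 1) * (1 - r ^ 2) * h3

/-! ### Nonnegative Fourier coefficients -/

/-- For `r < 1` this is the AM-GM inequality for `1, r², …, r^(2k)`, multiplied by `1 - r²`. -/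
theorem succ_mul_pow_le {r : ℝ} (h0 : 0 ≤ r) (h1 : r ≤ 1) (k : ℕ) :
    (k + 1) * r ^ k * (1 - r ^ 2) ≤ 1 - r ^ (2 * k + 2) := by
  induction k with
  | zero => simp
  | succ k ih =>
    -- Bernoulli at `r - 1` makes the increment of the defect from `k` to `k + 1` nonnegative.
    have hb := one_add_mul_le_pow (show (-2 : ℝ) ≤ r - 1 by linarith) (k + 1)
    have hb' : 0 ≤ r ^ (k + 1) - 1 + (k + 1) * (1 - r) := by
      have : (1 + (r - 1)) = r := by ring
      rw [this] at hb; push_cast at hb; linarith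
    have hk : 0 ≤ r ^ k := pow_nonneg h0 k
    have hr2 : 0 ≤ 1 - r ^ 2 := by nlinarith
    have hk1 : 0 ≤ r ^ k - r ^ (k + 1) := by
      rw [pow_succ]; nlinarith
    have hpow : r ^ (k + 1) ≤ 1 := pow_le_one₀ h0 h1
    have key : 0 ≤ (1 - r ^ 2) * (r ^ (k + 1) * (r ^ (k + 1) - 1 + (k + 1) * (1 - r)) +
        (k + 1) * (1 - r) * (r ^ k - r ^ (k + 1))) := by
      have : 0 ≤ 1 - r := by linarith
      positivity
    push_cast
    have e : 1 - r ^ (2 * (k + 1) + 2) - (k + 1 + 1) * r ^ (k + 1) * (1 - r ^ 2) -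
        (1 - r ^ (2 * k + 2) - (k + 1) * r ^ k * (1 - r ^ 2)) =
        (1 - r ^ 2) * (r ^ (k + 1) * (r ^ (k + 1) - 1 + (k + 1) * (1 - r)) +
        (k + 1) * (1 - r) * (r ^ k - r ^ (k + 1))) := by ring
    linarith

theorem minorantCoeff_nonneg {r : ℝ} (h0 : 0 < r) (h1 : r ≤ 1) {N m : ℕ} (hm : m < N) :
    0 ≤ minorantCoeff N r m := by
  -- With `N = m + k + 1`, the factor `r ^ (m + 1)` splits off and leaves the defect in
  -- `succ_mul_pow_le`.
  obtain ⟨k, rfl⟩ := Nat.exists_eq_add_of_lt hm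
  have h := succ_mul_pow_le h0.le h1 k
  have e : r ^ (2 * (m + k + 1) + 2) * r⁻¹ ^ (m + 1) = r ^ (m + 1) * r ^ (2 * k + 2) := by
    rw [inv_pow, show r ^ (2 * (m + k + 1) + 2) =
      r ^ (m + 1) * r ^ (2 * k + 2) * r ^ (m + 1) by ring]
    field_simp
  have e2 : minorantCoeff (m + k + 1) r m =
      r ^ (m + 1) * ((1 - r ^ (2 * k + 2)) - (k + 1) * r ^ k * (1 - r ^ 2)) := by
    unfold minorantCoeff
    rw [e]; push_cast; ring
  rw [e2]
  exact mul_nonneg (by positivity) (by linarith)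

/-! ### Lower bound for the Poisson energy -/

theorem norm_conj_mul {a b : ℂ} (ha : ‖a‖ = 1) (hb : ‖b‖ = 1) :
    ‖(starRingEnd ℂ) a * b‖ = 1 := by
  rw [norm_mul, Complex.norm_conj, ha, hb, one_mul]

/-- The double sum is `|∑ u_j ^ m|²`. -/
theorem sum_re_conj_mul_pow_nonneg {ι : Type*} [Fintype ι] (u : ι → ℂ) (m : ℕ) :
    0 ≤ ∑ j, ∑ k, (((starRingEnd ℂ) (u j) * u k) ^ m).re := by
  have h : ∑ j, ∑ k, (((starRingEnd ℂ) (u j) * u k) ^ m) =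
      (starRingEnd ℂ) (∑ j, u j ^ m) * ∑ k, u k ^ m := by
    rw [map_sum, Finset.sum_mul_sum]
    simp only [mul_pow, map_pow]
  have h2 : ∑ j, ∑ k, (((starRingEnd ℂ) (u j) * u k) ^ m).re =
      (∑ j, ∑ k, (((starRingEnd ℂ) (u j) * u k) ^ m)).re := by
    simp only [Complex.re_sum]
  rw [h2, h, mul_comm, Complex.mul_conj, Complex.ofReal_re]
  exact Complex.normSq_nonneg _

theorem le_sum_hermiteMinorant {n : ℕ} (u : Fin n → ℂ) {r : ℝ} (h0 : 0 < r) (h1 : r ≤ 1)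
    (N : ℕ) :
    (n : ℝ) ^ 2 * (1 - r ^ (2 * N + 2) - (N + 1) * (r ^ N * (1 - r ^ 2))) ≤
      ∑ j, ∑ k, hermiteMinorant N r ((starRingEnd ℂ) (u j) * u k) := by
  have h : ∑ j, ∑ k, hermiteMinorant N r ((starRingEnd ℂ) (u j) * u k) =
      (n : ℝ) ^ 2 * (1 - r ^ (2 * N + 2) - (N + 1) * (r ^ N * (1 - r ^ 2))) +
      2 * ∑ m ∈ Finset.range N, minorantCoeff N r m *
        ∑ j, ∑ k, (((starRingEnd ℂ) (u j) * u k) ^ (m + 1)).re := by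
    unfold hermiteMinorant
    simp only [Finset.sum_add_distrib, Finset.sum_const, Finset.card_univ, Fintype.card_fin,
      nsmul_eq_mul, ← Finset.mul_sum]
    congr 1
    · ring
    · congr 1
      simp only [Finset.mul_sum]
      rw [eq_comm, Finset.sum_comm]
      exact Finset.sum_congr rfl fun j _ => Finset.sum_comm
  rw [h]
  have : 0 ≤ ∑ m ∈ Finset.range N, minorantCoeff N r m *
        ∑ j, ∑ k, (((starRingEnd ℂ) (u j) * u k) ^ (m + 1)).re :=
    Finset.sum_nonneg fun m hm =>
      mul_nonneg (minorantCoeff_nonneg h0 h1 (Finset.mem_range.1 hm))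
        (sum_re_conj_mul_pow_nonneg u (m + 1))
  linarith

theorem sum_sum_eq_offDiag_add {ι : Type*} [Fintype ι] [DecidableEq ι] (f : ι → ι → ℝ) :
    ∑ j, ∑ k, f j k =
      ∑ p ∈ (Finset.univ : Finset ι).offDiag, f p.1 p.2 + ∑ j, f j j := by
  rw [← Finset.sum_product', ← Finset.diag_union_offDiag,
    Finset.sum_union (Finset.disjoint_diag_offDiag _), Finset.sum_diag, add_comm]

theorem poissonDenominator_pos {r c : ℝ} (h0 : 0 ≤ r) (h1 : r < 1) (hc : c ≤ 1) :
    0 < 1 - 2 * r * c + r ^ 2 := by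
  nlinarith [mul_nonneg h0 (sub_nonneg.2 hc), sq_pos_of_pos (sub_pos.2 h1)]

theorem re_conj_mul_le_one {a b : ℂ} (ha : ‖a‖ = 1) (hb : ‖b‖ = 1) :
    ((starRingEnd ℂ) a * b).re ≤ 1 :=
  norm_conj_mul ha hb ▸ Complex.re_le_norm _

/-- Among `N + 1` points of the unit circle, the Poisson energy is bounded below by that of the
regular polygon, with an explicit remainder. -/
theorem poisson_energy_le {N : ℕ} (u : Fin (N + 1) → ℂ) (hu : ∀ j, ‖u j‖ = 1) {r : ℝ}
    (h0 : 0 < r) (h1 : r < 1) :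
    ((N : ℝ) + 1) ^ 2 * (1 - r ^ (2 * N + 2)) -
        (N + 1) * ((1 + r) / (1 - r) * (1 - r ^ (N + 1)) ^ 2) +
      (1 - r ^ 2) * (1 - r) ^ 2 * r ^ N *
        ∑ p ∈ (Finset.univ : Finset (Fin (N + 1))).offDiag,
          fejerKernel N ((starRingEnd ℂ) (u p.1) * u p.2) /
            (1 - 2 * r * ((starRingEnd ℂ) (u p.1) * u p.2).re + r ^ 2) ≤
      (1 - r ^ (N + 1)) ^ 2 *
        ∑ p ∈ (Finset.univ : Finset (Fin (N + 1))).offDiag,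
          (1 - r ^ 2) / (1 - 2 * r * ((starRingEnd ℂ) (u p.1) * u p.2).re + r ^ 2) := by
  have h := le_sum_hermiteMinorant u h0 h1.le N
  rw [sum_sum_eq_offDiag_add] at h
  -- At `ζ = 1` the Fejér kernel is `(N + 1)²`. Summed over the `N + 1` diagonal pairs, the
  -- resulting correction cancels the term in `r ^ N` of the lower bound `h`.
  have hd : ∀ j, hermiteMinorant N r ((starRingEnd ℂ) (u j) * u j) =
      (1 + r) / (1 - r) * (1 - r ^ (N + 1)) ^ 2 - (1 - r ^ 2) * r ^ N * ((N : ℝ) + 1) ^ 2 := by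
    intro j
    have e : (starRingEnd ℂ) (u j) * u j = 1 := by
      rw [mul_comm, Complex.mul_conj, Complex.normSq_eq_norm_sq, hu j]; norm_num
    have hid := hermiteMinorant_identity (ζ := 1) (by simp) h0.ne' N
    rw [fejerKernel_one, Complex.one_re] at hid
    rw [e]
    have hr : 1 - r ≠ 0 := (sub_pos.2 h1).ne'
    have hr2 : (1 - r) ^ 2 ≠ 0 := pow_ne_zero 2 hr
    apply mul_left_cancel₀ hr2
    have e3 : (1 - r) ^ 2 * ((1 + r) / (1 - r) * (1 - r ^ (N + 1)) ^ 2) =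
        (1 - r ^ 2) * (1 - r ^ (N + 1)) ^ 2 := by
      field_simp; ring
    linear_combination hid - e3
  have ho : ∑ p ∈ (Finset.univ : Finset (Fin (N + 1))).offDiag,
      hermiteMinorant N r ((starRingEnd ℂ) (u p.1) * u p.2) =
      (1 - r ^ (N + 1)) ^ 2 *
        ∑ p ∈ (Finset.univ : Finset (Fin (N + 1))).offDiag,
          (1 - r ^ 2) / (1 - 2 * r * ((starRingEnd ℂ) (u p.1) * u p.2).re + r ^ 2) -
      (1 - r ^ 2) * (1 - r) ^ 2 * r ^ N *
        ∑ p ∈ (Finset.univ : Finset (Fin (N + 1))).offDiag,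
          fejerKernel N ((starRingEnd ℂ) (u p.1) * u p.2) /
            (1 - 2 * r * ((starRingEnd ℂ) (u p.1) * u p.2).re + r ^ 2) := by
    rw [Finset.mul_sum, Finset.mul_sum, ← Finset.sum_sub_distrib]
    refine Finset.sum_congr rfl fun p _ => ?_
    have hD := (poissonDenominator_pos h0.le h1 (re_conj_mul_le_one (hu p.1) (hu p.2))).ne'
    have hid := hermiteMinorant_identity (norm_conj_mul (hu p.1) (hu p.2)) h0.ne' N
    rw [← mul_div_assoc, ← mul_div_assoc, ← sub_div, eq_div_iff hD]
    linear_combination hid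
  rw [ho, Finset.sum_congr rfl fun j _ => hd j, Finset.sum_const, Finset.card_univ,
    Fintype.card_fin, nsmul_eq_mul] at h
  push_cast at h
  linarith

/-! ### Monotonicity in `r` -/

/-- Logarithm of the quotient of `∏_{j ≠ k} |1 - r ū_j u_k|` by its value for the regular
polygon. -/
noncomputable def logEnergyGap {n : ℕ} (u : Fin n → ℂ) (r : ℝ) : ℝ :=
  ∑ p ∈ (Finset.univ : Finset (Fin n)).offDiag,
      Real.log (1 - 2 * r * ((starRingEnd ℂ) (u p.1) * u p.2).re + r ^ 2) / 2 -
    n * Real.log (1 - r ^ n) + n * Real.log (1 - r)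

theorem hasDerivAt_logEnergyGap {N : ℕ} (u : Fin (N + 1) → ℂ) (hu : ∀ j, ‖u j‖ = 1) {r : ℝ}
    (h0 : 0 ≤ r) (h1 : r < 1) :
    HasDerivAt (logEnergyGap u)
      (∑ p ∈ (Finset.univ : Finset (Fin (N + 1))).offDiag,
        (r - ((starRingEnd ℂ) (u p.1) * u p.2).re) /
          (1 - 2 * r * ((starRingEnd ℂ) (u p.1) * u p.2).re + r ^ 2) +
        ((N : ℝ) + 1) ^ 2 * r ^ N / (1 - r ^ (N + 1)) - (N + 1) / (1 - r)) r := by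
  have hrn : r ^ (N + 1) < 1 := pow_lt_one₀ h0 h1 (by simp)
  have hA : HasDerivAt (fun r : ℝ => ∑ p ∈ (Finset.univ : Finset (Fin (N + 1))).offDiag,
      Real.log (1 - 2 * r * ((starRingEnd ℂ) (u p.1) * u p.2).re + r ^ 2) / 2)
      (∑ p ∈ (Finset.univ : Finset (Fin (N + 1))).offDiag,
        (r - ((starRingEnd ℂ) (u p.1) * u p.2).re) /
          (1 - 2 * r * ((starRingEnd ℂ) (u p.1) * u p.2).re + r ^ 2)) r := by
    refine HasDerivAt.fun_sum fun p _ => ?_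
    have hD := (poissonDenominator_pos h0 h1 (re_conj_mul_le_one (hu p.1) (hu p.2))).ne'
    set c := ((starRingEnd ℂ) (u p.1) * u p.2).re
    have h2 : HasDerivAt (fun r : ℝ => 1 - 2 * r * c + r ^ 2) (2 * (r - c)) r := by
      have := ((((hasDerivAt_id r).const_mul 2).mul_const c).const_sub 1).add
        ((hasDerivAt_id r).pow 2)
      refine this.congr_deriv ?_
      simp; ring
    refine ((h2.log hD).div_const 2).congr_deriv ?_
    ring
  have hB : HasDerivAt (fun r : ℝ => Real.log (1 - r ^ (N + 1)))
      (-(((N + 1 : ℕ) : ℝ) * r ^ N) / (1 - r ^ (N + 1))) r :=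
    (((hasDerivAt_pow (N + 1) r).const_sub 1).log (by linarith : 1 - r ^ (N + 1) ≠ 0))
  have hC : HasDerivAt (fun r : ℝ => Real.log (1 - r)) (-1 / (1 - r)) r :=
    (((hasDerivAt_id r).const_sub 1).log (by simp; linarith))
  have := (hA.sub (hB.const_mul ((N + 1 : ℕ) : ℝ))).add (hC.const_mul ((N + 1 : ℕ) : ℝ))
  refine this.congr_deriv ?_
  push_cast
  ring

/-- Each pair contributes `2r(r - c)/D = 1 - (1 - r²)/D` with `D = 1 - 2rc + r²`, so the derivative
is a constant minus the Poisson energy and `poisson_energy_le` applies. -/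
theorem mul_deriv_logEnergyGap_le {N : ℕ} (u : Fin (N + 1) → ℂ) (hu : ∀ j, ‖u j‖ = 1) {r : ℝ}
    (h0 : 0 < r) (h1 : r < 1) :
    2 * r * (1 - r ^ (N + 1)) ^ 2 * deriv (logEnergyGap u) r ≤
      - ((1 - r ^ 2) * (1 - r) ^ 2 * r ^ N *
        ∑ p ∈ (Finset.univ : Finset (Fin (N + 1))).offDiag,
          fejerKernel N ((starRingEnd ℂ) (u p.1) * u p.2) /
            (1 - 2 * r * ((starRingEnd ℂ) (u p.1) * u p.2).re + r ^ 2)) := by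
  rw [(hasDerivAt_logEnergyGap u hu h0.le h1).deriv]
  have h := poisson_energy_le u hu h0 h1
  have hrn : r ^ (N + 1) < 1 := pow_lt_one₀ h0.le h1 (by simp)
  have hs : 2 * r * ∑ p ∈ (Finset.univ : Finset (Fin (N + 1))).offDiag,
        (r - ((starRingEnd ℂ) (u p.1) * u p.2).re) /
          (1 - 2 * r * ((starRingEnd ℂ) (u p.1) * u p.2).re + r ^ 2) =
      ((N : ℝ) + 1) ^ 2 - (N + 1) - ∑ p ∈ (Finset.univ : Finset (Fin (N + 1))).offDiag,
          (1 - r ^ 2) / (1 - 2 * r * ((starRingEnd ℂ) (u p.1) * u p.2).re + r ^ 2) := by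
    have hcard : ((N : ℝ) + 1) ^ 2 - (N + 1) =
        ∑ p ∈ (Finset.univ : Finset (Fin (N + 1))).offDiag, (1 : ℝ) := by
      rw [Finset.sum_const, Finset.offDiag_card, Finset.card_univ, Fintype.card_fin,
        nsmul_eq_mul, mul_one, Nat.cast_sub (Nat.le_mul_self _)]
      push_cast; ring
    rw [hcard, ← Finset.sum_sub_distrib, Finset.mul_sum]
    refine Finset.sum_congr rfl fun p _ => ?_
    have hD := (poissonDenominator_pos h0.le h1 (re_conj_mul_le_one (hu p.1) (hu p.2))).ne'
    field_simp
    ring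
  have e1 : (1 - r ^ (N + 1)) ^ 2 * (2 * r * (((N : ℝ) + 1) ^ 2 * r ^ N / (1 - r ^ (N + 1)))) =
      2 * ((N : ℝ) + 1) ^ 2 * r ^ (N + 1) * (1 - r ^ (N + 1)) := by
    have : 1 - r ^ (N + 1) ≠ 0 := by linarith
    rw [eq_comm, pow_two (1 - r ^ (N + 1)), mul_assoc (1 - r ^ (N + 1)),
      mul_left_comm (1 - r ^ (N + 1)) (2 * r), mul_div_cancel₀ _ this]
    ring
  have e2 : 2 * r * ((N + 1) / (1 - r)) = ((N : ℝ) + 1) * ((1 + r) / (1 - r)) - (N + 1) := by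
    have : 1 - r ≠ 0 := by linarith
    field_simp; ring
  have e3 : ∀ S : ℝ, 2 * r * (1 - r ^ (N + 1)) ^ 2 *
      (S + ((N : ℝ) + 1) ^ 2 * r ^ N / (1 - r ^ (N + 1)) - (N + 1) / (1 - r)) =
      (1 - r ^ (N + 1)) ^ 2 * (2 * r * S) +
      2 * ((N : ℝ) + 1) ^ 2 * r ^ (N + 1) * (1 - r ^ (N + 1)) -
      (1 - r ^ (N + 1)) ^ 2 * (((N : ℝ) + 1) * ((1 + r) / (1 - r)) - (N + 1)) := by
    intro S
    rw [← e1, ← e2]; ring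
  rw [e3, hs]
  have e4 : r ^ (2 * N + 2) = (r ^ (N + 1)) ^ 2 := by ring
  rw [e4] at h
  linarith

theorem continuousOn_logEnergyGap {N : ℕ} (u : Fin (N + 1) → ℂ) (hu : ∀ j, ‖u j‖ = 1) :
    ContinuousOn (logEnergyGap u) (Set.Ico 0 1) := fun _ hr =>
  (hasDerivAt_logEnergyGap u hu hr.1 hr.2).continuousAt.continuousWithinAt

theorem logEnergyGap_zero {N : ℕ} (u : Fin (N + 1) → ℂ) : logEnergyGap u 0 = 0 := by
  simp [logEnergyGap]

theorem fejerKernel_div_nonneg {N : ℕ} (u : Fin (N + 1) → ℂ) (hu : ∀ j, ‖u j‖ = 1) {r : ℝ}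
    (h0 : 0 ≤ r) (h1 : r < 1) (p : Fin (N + 1) × Fin (N + 1)) :
    0 ≤ fejerKernel N ((starRingEnd ℂ) (u p.1) * u p.2) /
      (1 - 2 * r * ((starRingEnd ℂ) (u p.1) * u p.2).re + r ^ 2) :=
  div_nonneg (fejerKernel_nonneg (norm_conj_mul (hu p.1) (hu p.2)) N)
    (poissonDenominator_pos h0 h1 (re_conj_mul_le_one (hu p.1) (hu p.2))).le

theorem remainder_factor_pos {r : ℝ} (h0 : 0 < r) (h1 : r < 1) (N : ℕ) :
    0 < (1 - r ^ 2) * (1 - r) ^ 2 * r ^ N := by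
  have : 0 < 1 - r := by linarith
  have : 0 < 1 - r ^ 2 := by nlinarith
  positivity

theorem logEnergyGap_nonpos {N : ℕ} (u : Fin (N + 1) → ℂ) (hu : ∀ j, ‖u j‖ = 1) {r : ℝ}
    (h0 : 0 ≤ r) (h1 : r < 1) : logEnergyGap u r ≤ 0 := by
  rw [← logEnergyGap_zero u]
  refine antitoneOn_of_deriv_nonpos (convex_Ico 0 1) (continuousOn_logEnergyGap u hu)
    ?_ ?_ (by simp) ⟨h0, h1⟩ h0
  · rw [interior_Ico]
    exact fun x hx =>
      (hasDerivAt_logEnergyGap u hu hx.1.le hx.2).differentiableAt.differentiableWithinAt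
  · rw [interior_Ico]
    intro x hx
    have h := mul_deriv_logEnergyGap_le u hu hx.1 hx.2
    have hxn : x ^ (N + 1) < 1 := pow_lt_one₀ hx.1.le hx.2 (by simp)
    have hpos : 0 < 2 * x * (1 - x ^ (N + 1)) ^ 2 :=
      mul_pos (by linarith [hx.1]) (pow_pos (by linarith) 2)
    by_contra hlt
    have h2 := mul_pos hpos (not_le.1 hlt)
    have h3 := mul_nonneg (remainder_factor_pos hx.1 hx.2 N).le
      (Finset.sum_nonneg fun p (_ : p ∈ (Finset.univ : Finset (Fin (N + 1))).offDiag) =>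
        fejerKernel_div_nonneg u hu hx.1.le hx.2 p)
    linarith

/-- The numerator `fejerKernel` does not depend on `r`, so one nonzero pair makes the derivative
negative on all of `(0, 1)`. -/
theorem logEnergyGap_neg {N : ℕ} (u : Fin (N + 1) → ℂ) (hu : ∀ j, ‖u j‖ = 1) {r : ℝ}
    (h0 : 0 < r) (h1 : r < 1) {j k : Fin (N + 1)} (hjk : j ≠ k)
    (hne : fejerKernel N ((starRingEnd ℂ) (u j) * u k) ≠ 0) : logEnergyGap u r < 0 := by
  rw [← logEnergyGap_zero u]
  refine strictAntiOn_of_deriv_neg (convex_Ico 0 1) (continuousOn_logEnergyGap u hu)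
    ?_ (by simp) ⟨h0.le, h1⟩ h0
  rw [interior_Ico]
  intro x hx
  have h := mul_deriv_logEnergyGap_le u hu hx.1 hx.2
  have hxn : x ^ (N + 1) < 1 := pow_lt_one₀ hx.1.le hx.2 (by simp)
  have hpos : 0 < 2 * x * (1 - x ^ (N + 1)) ^ 2 :=
    mul_pos (by linarith [hx.1]) (pow_pos (by linarith) 2)
  by_contra hlt
  have h2 := mul_nonneg hpos.le (not_lt.1 hlt)
  have h3 := mul_pos (remainder_factor_pos hx.1 hx.2 N)
    (Finset.sum_pos' (fun p (_ : p ∈ (Finset.univ : Finset (Fin (N + 1))).offDiag) =>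
      fejerKernel_div_nonneg u hu hx.1.le hx.2 p)
      ⟨(j, k), by simpa using hjk, div_pos
        (lt_of_le_of_ne (fejerKernel_nonneg (norm_conj_mul (hu j) (hu k)) N) hne.symm)
        (poissonDenominator_pos hx.1.le hx.2 (re_conj_mul_le_one (hu j) (hu k)))⟩)
  linarith

/-! ### Points on the circle of radius `ρ` -/

/-- For `|ζ| = 1`, reflection in the unit circle gives `|1 - ρ²ζ| = ρ² |1 - ρ⁻²ζ|`, which brings the
parameter into `(0, 1)`. -/
theorem log_norm_one_sub_conj_mul {ρ : ℝ} (hρ : 1 < ρ) {a b : ℂ} (ha : ‖a‖ = 1) (hb : ‖b‖ = 1) :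
    0 < ‖1 - (starRingEnd ℂ) (ρ * a) * (ρ * b)‖ ∧
    Real.log ‖1 - (starRingEnd ℂ) (ρ * a) * (ρ * b)‖ = Real.log (ρ ^ 2) +
      Real.log (1 - 2 * (ρ ^ 2)⁻¹ * ((starRingEnd ℂ) a * b).re + (ρ ^ 2)⁻¹ ^ 2) / 2 := by
  have hρ0 : ρ ≠ 0 := by linarith
  have hr1 : (ρ ^ 2)⁻¹ < 1 := inv_lt_one_of_one_lt₀ (one_lt_pow₀ hρ two_ne_zero)
  have hD := poissonDenominator_pos (r := (ρ ^ 2)⁻¹) (by positivity) hr1 (re_conj_mul_le_one ha hb)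
  have hn := norm_conj_mul ha hb
  set ζ := (starRingEnd ℂ) a * b with hζ
  have e1 : 1 - (starRingEnd ℂ) (ρ * a) * (ρ * b) = 1 - ((ρ ^ 2 : ℝ) : ℂ) * ζ := by
    rw [map_mul, Complex.conj_ofReal, hζ]; push_cast; ring
  have e2 : ‖1 - ((ρ ^ 2 : ℝ) : ℂ) * ζ‖ ^ 2 =
      (ρ ^ 2) ^ 2 * (1 - 2 * (ρ ^ 2)⁻¹ * ζ.re + (ρ ^ 2)⁻¹ ^ 2) := by
    have hre : ζ.re * ζ.re + ζ.im * ζ.im = 1 := by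
      rw [← Complex.normSq_apply, Complex.normSq_eq_norm_sq, hn]; norm_num
    rw [← Complex.normSq_eq_norm_sq, Complex.normSq_apply]
    simp only [Complex.sub_re, Complex.sub_im, Complex.re_ofReal_mul, Complex.im_ofReal_mul,
      Complex.one_re, Complex.one_im]
    field_simp
    linear_combination ρ ^ 4 * hre
  rw [e1]
  have hpos : 0 < ‖1 - ((ρ ^ 2 : ℝ) : ℂ) * ζ‖ ^ 2 := by rw [e2]; positivity
  have hpos' : 0 < ‖1 - ((ρ ^ 2 : ℝ) : ℂ) * ζ‖ :=
    lt_of_le_of_ne (norm_nonneg _) fun h => by rw [← h] at hpos; simp at hpos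
  refine ⟨hpos', ?_⟩
  have h := congrArg Real.log e2
  rw [Real.log_pow, Real.log_mul (by positivity) hD.ne', Real.log_pow (n := 2) (x := ρ ^ 2)] at h
  simp only [Nat.cast_ofNat] at h
  linarith

/-- The product `∏_{j ≠ k} |1 - z̄_j z_k|`. -/
noncomputable def conjProduct {n : ℕ} (z : Fin n → ℂ) : ℝ :=
  ∏ p ∈ (Finset.univ : Finset (Fin n)).offDiag, ‖1 - (starRingEnd ℂ) (z p.1) * z p.2‖

theorem polygonBound_pos {n : ℕ} (hn : n ≠ 0) {ρ : ℝ} (hρ : 1 < ρ) :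
    0 < ((ρ ^ (2 * n) - 1) / (ρ ^ 2 - 1)) ^ n := by
  have h1 : 1 < ρ ^ (2 * n) := one_lt_pow₀ hρ (by omega)
  have h2 : 1 < ρ ^ 2 := one_lt_pow₀ hρ two_ne_zero
  have h3 : 0 < ρ ^ (2 * n) - 1 := by linarith
  have h4 : 0 < ρ ^ 2 - 1 := by linarith
  positivity

/-- With `n = N + 1` and `r = ρ⁻²`, the `n(n - 1)` factors `ρ²` match those in `(ρ^(2n) - 1)/(ρ² -
1) = ρ^(2(n - 1)) (1 - r^n)/(1 - r)`. -/
theorem conjProduct_pos_and_log {N : ℕ} {ρ : ℝ} (hρ : 1 < ρ) (u : Fin (N + 1) → ℂ)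
    (hu : ∀ j, ‖u j‖ = 1) :
    0 < conjProduct (fun j => ρ * u j) ∧
    Real.log (conjProduct fun j => ρ * u j) =
      Real.log (((ρ ^ (2 * (N + 1)) - 1) / (ρ ^ 2 - 1)) ^ (N + 1)) +
        logEnergyGap u (ρ ^ 2)⁻¹ := by
  have hl := fun p : Fin (N + 1) × Fin (N + 1) =>
    log_norm_one_sub_conj_mul hρ (hu p.1) (hu p.2)
  refine ⟨Finset.prod_pos fun p _ => (hl p).1, ?_⟩
  have h1 : 1 < ρ ^ (2 * (N + 1)) := one_lt_pow₀ hρ (by omega)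
  have h2 : 1 < ρ ^ 2 := one_lt_pow₀ hρ two_ne_zero
  have hρ0 : ρ ≠ 0 := by linarith
  unfold conjProduct logEnergyGap
  rw [Real.log_prod fun p _ => (hl p).1.ne', Finset.sum_congr rfl fun p _ => (hl p).2,
    Finset.sum_add_distrib, Finset.sum_const, Finset.offDiag_card, Finset.card_univ,
    Fintype.card_fin, nsmul_eq_mul, Nat.cast_sub (Nat.le_mul_self _),
    Real.log_pow (n := N + 1) (x := (ρ ^ (2 * (N + 1)) - 1) / (ρ ^ 2 - 1)),
    Real.log_div (by linarith) (by linarith)]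
  have e1 : 1 - (ρ ^ 2)⁻¹ ^ (N + 1) = (ρ ^ (2 * (N + 1)) - 1) / (ρ ^ 2) ^ (N + 1) := by
    rw [inv_pow, pow_mul]; field_simp
  have e2 : 1 - (ρ ^ 2)⁻¹ = (ρ ^ 2 - 1) / ρ ^ 2 := by field_simp
  rw [e1, e2, Real.log_div (by linarith) (by positivity), Real.log_div (by linarith)
    (by positivity), Real.log_pow (n := N + 1) (x := ρ ^ 2)]
  push_cast
  ring

theorem norm_div_ofReal_eq_one {ρ : ℝ} (hρ : 0 < ρ) {a : ℂ} (ha : ‖a‖ = ρ) : ‖a / ρ‖ = 1 := by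
  rw [norm_div, ha, Complex.norm_real, Real.norm_of_nonneg hρ.le, div_self hρ.ne']

theorem conjProduct_le_of_norm_eq {N : ℕ} {ρ : ℝ} (hρ : 1 < ρ) (z : Fin (N + 1) → ℂ)
    (hz : ∀ j, ‖z j‖ = ρ) :
    conjProduct z ≤ ((ρ ^ (2 * (N + 1)) - 1) / (ρ ^ 2 - 1)) ^ (N + 1) ∧
    (conjProduct z = ((ρ ^ (2 * (N + 1)) - 1) / (ρ ^ 2 - 1)) ^ (N + 1) →
      ∀ j k, j ≠ k → fejerKernel N ((starRingEnd ℂ) (z j / ρ) * (z k / ρ)) = 0) := by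
  have hρ0 : (0 : ℝ) < ρ := by linarith
  have hρC : (ρ : ℂ) ≠ 0 := Complex.ofReal_ne_zero.2 hρ0.ne'
  have hu : ∀ j, ‖z j / ρ‖ = 1 := fun j => norm_div_ofReal_eq_one hρ0 (hz j)
  obtain ⟨hpos, hlog⟩ := conjProduct_pos_and_log hρ (fun j => z j / ρ) hu
  have e : (fun j => (ρ : ℂ) * (z j / ρ)) = z := by
    funext j; exact mul_div_cancel₀ _ hρC
  rw [e] at hpos hlog
  have hr0 : 0 < (ρ ^ 2)⁻¹ := by positivity
  have hr1 : (ρ ^ 2)⁻¹ < 1 := inv_lt_one_of_one_lt₀ (one_lt_pow₀ hρ two_ne_zero)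
  have hB := polygonBound_pos (Nat.succ_ne_zero N) hρ
  constructor
  · rw [← Real.log_le_log_iff hpos hB, hlog]
    linarith [logEnergyGap_nonpos (fun j => z j / ρ) hu hr0.le hr1]
  · intro heq j k hjk
    by_contra hne
    have := logEnergyGap_neg (fun j => z j / ρ) hu hr0 hr1 hjk hne
    rw [heq] at hlog
    linarith

/-! ### Regular polygons and equality on the circle -/

theorem exp_eq_rootOfUnity_pow (n m : ℕ) :
    Complex.exp (2 * (Real.pi : ℂ) * Complex.I * (m : ℂ) / (n : ℂ)) =
      Complex.exp (2 * (Real.pi : ℂ) * Complex.I / (n : ℂ)) ^ m := by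
  rw [← Complex.exp_nat_mul]; congr 1; ring

/-- Take `w = z 0`. The ratios to it are `(N + 1)`-st roots of unity, and no ratio of two different
points is `1`, so the exponents form a permutation. -/
theorem isRegularNGonVertices_of_fejerKernel_eq_zero {N : ℕ} {ρ : ℝ} (hρ : 0 < ρ)
    (z : Fin (N + 1) → ℂ) (hz : ∀ j, ‖z j‖ = ρ)
    (h : ∀ j k, j ≠ k → fejerKernel N ((starRingEnd ℂ) (z j / ρ) * (z k / ρ)) = 0) :
    IsRegularNGonVertices (N + 1) ρ z := by
  have hρC : (ρ : ℂ) ≠ 0 := Complex.ofReal_ne_zero.2 hρ.ne'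
  have hu : ∀ j, ‖z j / ρ‖ = 1 := fun j => norm_div_ofReal_eq_one hρ (hz j)
  have hself : ∀ j, (starRingEnd ℂ) (z j / ρ) * (z j / ρ) = 1 := fun j => by
    rw [mul_comm, Complex.mul_conj, Complex.normSq_eq_norm_sq, hu j]; norm_num
  have hp := Complex.isPrimitiveRoot_exp (N + 1) (Nat.succ_ne_zero N)
  have hroot : ∀ k, ∃ i : Fin (N + 1),
      Complex.exp (2 * Real.pi * Complex.I / ((N + 1 : ℕ) : ℂ)) ^ (i : ℕ) =
        (starRingEnd ℂ) (z 0 / ρ) * (z k / ρ) := by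
    intro k
    have h1 : ((starRingEnd ℂ) (z 0 / ρ) * (z k / ρ)) ^ (N + 1) = 1 := by
      rcases eq_or_ne 0 k with rfl | hk
      · rw [hself, one_pow]
      · exact (pow_eq_one_of_fejerKernel_eq_zero (norm_conj_mul (hu 0) (hu k)) (h 0 k hk)).1
    obtain ⟨i, hi, hi2⟩ := hp.eq_pow_of_pow_eq_one h1
    exact ⟨⟨i, hi⟩, hi2⟩
  choose f hf using hroot
  have hzf : ∀ k, z k = z 0 * Complex.exp (2 * Real.pi * Complex.I / ((N + 1 : ℕ) : ℂ)) ^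
      (f k : ℕ) := by
    intro k
    rw [hf k]
    calc z k = ρ * ((starRingEnd ℂ) (z 0 / ρ) * (z 0 / ρ)) * (z k / ρ) := by
          rw [hself 0, mul_one, mul_div_cancel₀ _ hρC]
      _ = ρ * (z 0 / ρ) * ((starRingEnd ℂ) (z 0 / ρ) * (z k / ρ)) := by ring
      _ = _ := by rw [mul_div_cancel₀ (z 0) hρC]
  have hinj : Function.Injective f := by
    intro j k hjk
    by_contra hne
    have h2 := (pow_eq_one_of_fejerKernel_eq_zero (norm_conj_mul (hu j) (hu k)) (h j k hne)).2
    apply h2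
    have : z k = z j := by rw [hzf k, hzf j, hjk]
    rw [this, hself]
  refine ⟨z 0, hz 0, Equiv.ofBijective f (Finite.injective_iff_bijective.1 hinj), fun j => ?_⟩
  rw [exp_eq_rootOfUnity_pow, Equiv.ofBijective_apply]
  exact hzf j

theorem IsRegularNGonVertices.sum_eq_zero {n : ℕ} (hn : 2 ≤ n) {ρ : ℝ} {z : Fin n → ℂ}
    (h : IsRegularNGonVertices n ρ z) : ∑ j, z j = 0 := by
  obtain ⟨w, -, σ, hσ⟩ := h
  have hp := Complex.isPrimitiveRoot_exp n (by omega)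
  simp only [hσ, exp_eq_rootOfUnity_pow]
  rw [← Finset.mul_sum, Equiv.sum_comp σ fun i : Fin n =>
    Complex.exp (2 * (Real.pi : ℂ) * Complex.I / (n : ℂ)) ^ (i : ℕ),
    Fin.sum_univ_eq_sum_range fun i => Complex.exp (2 * (Real.pi : ℂ) * Complex.I / (n : ℂ)) ^ i,
    hp.geom_sum_eq_zero (by omega), mul_zero]

theorem IsRegularNGonVertices.conjProduct_eq {n : ℕ} (hn : n ≠ 0) {ρ : ℝ} (hρ : 1 < ρ)
    {z : Fin n → ℂ} (h : IsRegularNGonVertices n ρ z) :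
    conjProduct z = ((ρ ^ (2 * n) - 1) / (ρ ^ 2 - 1)) ^ n := by
  have : NeZero n := ⟨hn⟩
  obtain ⟨w, hw, σ, hσ⟩ := h
  have hp := Complex.isPrimitiveRoot_exp n hn
  simp only [exp_eq_rootOfUnity_pow] at hσ
  set ω := Complex.exp (2 * (Real.pi : ℂ) * Complex.I / (n : ℂ)) with hω
  have h1 : 1 < ρ ^ (2 * n) := one_lt_pow₀ hρ (by omega)
  have h2 : 1 < ρ ^ 2 := one_lt_pow₀ hρ two_ne_zero
  have hz : ∀ j, ‖z j‖ = ρ := fun j => by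
    rw [hσ, norm_mul, norm_pow, hp.norm'_eq_one hn, one_pow, mul_one, hw]
  have hpow : ∀ j, z j ^ n = w ^ n := fun j => by
    rw [hσ, mul_pow, ← pow_mul, mul_comm (σ j : ℕ), pow_mul, hp.pow_eq_one, one_pow, mul_one]
  have hconj : ∀ a : ℂ, ‖a‖ = ρ → (starRingEnd ℂ) a * a = ((ρ ^ 2 : ℝ) : ℂ) := fun a ha => by
    rw [mul_comm, Complex.mul_conj, Complex.normSq_eq_norm_sq, ha]
  -- Including `k = j` makes each row a full factorisation of `1 - (a w)^n`. The diagonal is divided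
  -- out at the end.
  have hprod : ∀ a : ℂ, ∏ k, (1 - a * z k) = 1 - (a * w) ^ n := by
    intro a
    have e := hp.pow_sub_pow_eq_prod_sub_mul 1 (a * w) (Nat.pos_of_ne_zero hn)
    rw [one_pow] at e
    rw [e]
    have e2 : ∏ k, (1 - a * z k) = ∏ i : Fin n, (1 - a * (w * ω ^ (i : ℕ))) := by
      simp only [hσ]
      exact Equiv.prod_comp σ fun i : Fin n => 1 - a * (w * ω ^ (i : ℕ))
    rw [e2]
    refine Finset.prod_bij (fun i _ => ω ^ (i : ℕ)) ?_ ?_ ?_ ?_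
    · intro i _
      rw [Polynomial.mem_nthRootsFinset (Nat.pos_of_ne_zero hn), ← pow_mul, mul_comm, pow_mul,
        hp.pow_eq_one, one_pow]
    · intro i _ k _ hik
      exact Fin.ext (hp.pow_inj i.2 k.2 hik)
    · intro b hb
      rw [Polynomial.mem_nthRootsFinset (Nat.pos_of_ne_zero hn)] at hb
      obtain ⟨i, hi, hi2⟩ := hp.eq_pow_of_pow_eq_one hb
      exact ⟨⟨i, hi⟩, Finset.mem_univ _, hi2⟩
    · intro i _
      ring
  have hrow : ∀ j, ∏ k, ‖1 - (starRingEnd ℂ) (z j) * z k‖ = ρ ^ (2 * n) - 1 := by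
    intro j
    rw [← norm_prod, hprod, mul_pow, ← hpow j, ← mul_pow, hconj _ (hz j), ← Complex.ofReal_pow,
      ← pow_mul, ← Complex.ofReal_one, ← Complex.ofReal_sub, Complex.norm_real, Real.norm_eq_abs,
      abs_sub_comm, abs_of_pos (by linarith)]
  have hdiag : ∀ j, ‖1 - (starRingEnd ℂ) (z j) * z j‖ = ρ ^ 2 - 1 := by
    intro j
    rw [hconj _ (hz j), ← Complex.ofReal_one, ← Complex.ofReal_sub, Complex.norm_real,
      Real.norm_eq_abs, abs_sub_comm, abs_of_pos (by linarith)]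
  have htot : ∏ j, ∏ k, ‖1 - (starRingEnd ℂ) (z j) * z k‖ =
      conjProduct z * ∏ j, ‖1 - (starRingEnd ℂ) (z j) * z j‖ := by
    rw [← Finset.prod_product', ← Finset.diag_union_offDiag,
      Finset.prod_union (Finset.disjoint_diag_offDiag _), Finset.prod_diag, mul_comm]
    rfl
  rw [Finset.prod_congr rfl fun j _ => hrow j, Finset.prod_congr rfl fun j _ => hdiag j,
    Finset.prod_const, Finset.prod_const, Finset.card_univ, Fintype.card_fin] at htot
  rw [div_pow, eq_div_iff (pow_ne_zero n (by linarith)), htot]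

/-! ### Reduction to the circle by the maximum principle -/

/-- The factors with `p.1 = j` are antiholomorphic in `w`; conjugating them keeps their norms. Off
the diagonal no factor contains both `w` and its conjugate. -/
theorem exists_holomorphic_conjProduct_update {n : ℕ} (z : Fin n → ℂ) (j : Fin n) :
    ∃ g : ℂ → ℂ, Differentiable ℂ g ∧ ∀ w, ‖g w‖ = conjProduct (Function.update z j w) := by
  refine ⟨fun w => ∏ p ∈ (Finset.univ : Finset (Fin n)).offDiag,
    (if p.1 = j then 1 - (starRingEnd ℂ) (z p.2) * w else
      if p.2 = j then 1 - (starRingEnd ℂ) (z p.1) * w else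
        1 - (starRingEnd ℂ) (z p.1) * z p.2), ?_, fun w => ?_⟩
  · refine Differentiable.fun_finsetProd fun p _ => ?_
    split_ifs <;> fun_prop
  · rw [norm_prod]
    refine Finset.prod_congr rfl fun p hp => ?_
    have hne : p.1 ≠ p.2 := (Finset.mem_offDiag.1 hp).2.2
    split_ifs with h1 h2
    · have h2 : p.2 ≠ j := fun h => hne (h1.trans h.symm)
      rw [h1, Function.update_self, Function.update_of_ne h2, ← Complex.norm_conj]
      simp only [map_sub, map_one, map_mul, Complex.conj_conj]
      rw [mul_comm]
    · rw [h2, Function.update_self, Function.update_of_ne h1]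
    · rw [Function.update_of_ne h1, Function.update_of_ne h2]

theorem conjProduct_le {N : ℕ} {ρ : ℝ} (hρ : 1 < ρ) (z : Fin (N + 1) → ℂ)
    (hz : ∀ j, ‖z j‖ ≤ ρ) :
    conjProduct z ≤ ((ρ ^ (2 * (N + 1)) - 1) / (ρ ^ 2 - 1)) ^ (N + 1) ∧
    (2 ≤ N + 1 → conjProduct z = ((ρ ^ (2 * (N + 1)) - 1) / (ρ ^ 2 - 1)) ^ (N + 1) →
      IsRegularNGonVertices (N + 1) ρ z) := by
  have hρ0 : (0 : ℝ) < ρ := by linarith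
  -- Induction on the number of points off the circle: moving one of them onto it lowers this
  -- number.
  induction hs : (Finset.univ.filter fun j => ‖z j‖ ≠ ρ).card using Nat.strong_induction_on
    generalizing z with
  | _ s ih =>
    subst hs
    by_cases hall : ∀ j, ‖z j‖ = ρ
    · obtain ⟨h1, h2⟩ := conjProduct_le_of_norm_eq hρ z hall
      exact ⟨h1, fun _ h => isRegularNGonVertices_of_fejerKernel_eq_zero hρ0 z hall (h2 h)⟩
    obtain ⟨j, hj⟩ := not_forall.1 hall
    have hjlt : ‖z j‖ < ρ := lt_of_le_of_ne (hz j) hj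
    have hup := fun (w : ℂ) (hw : ‖w‖ = ρ) => ih
      (Finset.univ.filter fun i => ‖Function.update z j w i‖ ≠ ρ).card
      (by
        refine Finset.card_lt_card (Finset.ssubset_iff_of_subset ?_ |>.2 ⟨j, ?_, ?_⟩)
        · intro i hi
          rcases eq_or_ne i j with rfl | hij
          · simpa using hj
          · simpa [Function.update_of_ne hij] using hi
        · simpa using hj
        · simpa using hw)
      (Function.update z j w)
      (fun i => by
        rcases eq_or_ne i j with rfl | hij
        · rw [Function.update_self, hw]
        · rw [Function.update_of_ne hij]; exact hz i) rfl
    obtain ⟨g, hg, hgz⟩ := exists_holomorphic_conjProduct_update z j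
    set M := ((ρ ^ (2 * (N + 1)) - 1) / (ρ ^ 2 - 1)) ^ (N + 1)
    have hball : ∀ w ∈ closure (Metric.ball (0 : ℂ) ρ), ‖g w‖ ≤ M := by
      intro w hw
      refine Complex.norm_le_of_forall_mem_frontier_norm_le Metric.isBounded_ball
        hg.diffContOnCl (fun v hv => ?_) hw
      rw [frontier_ball _ hρ0.ne', mem_sphere_zero_iff_norm] at hv
      rw [hgz]; exact (hup v hv).1
    have hself : ‖g (z j)‖ = conjProduct z := by rw [hgz, Function.update_eq_self]
    have hmem : z j ∈ Metric.ball (0 : ℂ) ρ := mem_ball_zero_iff.2 hjlt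
    refine ⟨hself ▸ hball _ (subset_closure hmem), fun h2 heq => ?_⟩
    have hmax : IsMaxOn (norm ∘ g) (Metric.ball 0 ρ) (z j) := fun w hw => by
      simp only [Set.mem_ofPred_eq, Function.comp_apply, hself, heq]
      exact hball w (subset_closure hw)
    -- An interior maximum makes `‖g‖` constant up to the boundary, so equality holds with `z j`
    -- replaced by any `w` on the circle.
    have hconst := Complex.norm_eqOn_closure_of_isPreconnected_of_isMaxOn
      (convex_ball (0 : ℂ) ρ).isPreconnected Metric.isOpen_ball hg.diffContOnCl hmem hmax
    have hsum : ∀ w : ℂ, ‖w‖ = ρ → w + ∑ i ∈ Finset.univ.erase j, z i = 0 := by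
      intro w hw
      have hwcl : w ∈ closure (Metric.ball (0 : ℂ) ρ) := by
        rw [closure_ball _ hρ0.ne', mem_closedBall_zero_iff, hw]
      have hreg := (hup w hw).2 h2 (by
        rw [← hgz, ← heq, ← hself]; exact hconst hwcl)
      have h0 := hreg.sum_eq_zero h2
      rw [← Finset.add_sum_erase _ _ (Finset.mem_univ j), Function.update_self] at h0
      rw [← h0]
      congr 1
      exact Finset.sum_congr rfl fun i hi =>
        (Function.update_of_ne (Finset.ne_of_mem_erase hi) _ _).symm
    -- The vertices of a regular polygon sum to zero, so two different values of `w` contradict each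
    -- other.
    have ha := hsum ρ (by rw [Complex.norm_real, Real.norm_of_nonneg hρ0.le])
    have hb := hsum (-ρ) (by rw [norm_neg, Complex.norm_real, Real.norm_of_nonneg hρ0.le])
    have : (ρ : ℂ) = 0 := by linear_combination (ha - hb) / 2
    exact absurd (Complex.ofReal_eq_zero.1 this) hρ0.ne'

theorem theorem1 (n : ℕ) (ρ : ℝ) (hρ : 1 < ρ) (z : Fin n → ℂ) (hz : ∀ j : Fin n, ‖z j‖ ≤ ρ) :
    (∏ p ∈ (Finset.univ : Finset (Fin n)).offDiag,
        ‖1 - (starRingEnd ℂ) (z p.1) * z p.2‖ ≤ ((ρ ^ (2 * n) - 1) / (ρ ^ 2 - 1)) ^ n) ∧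
      (2 ≤ n →
        (∏ p ∈ (Finset.univ : Finset (Fin n)).offDiag,
            ‖1 - (starRingEnd ℂ) (z p.1) * z p.2‖ = ((ρ ^ (2 * n) - 1) / (ρ ^ 2 - 1)) ^ n ↔
          IsRegularNGonVertices n ρ z)) := by
  rcases n with _ | N
  -- For `n = 0` both sides are `1`.
  · refine ⟨by simp, fun h => by omega⟩
  · obtain ⟨h1, h2⟩ := conjProduct_le hρ z hz
    exact ⟨h1, fun hn => ⟨h2 hn, fun h => h.conjProduct_eq (Nat.succ_ne_zero N) hρ⟩⟩
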